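/- Let $X_1,X_2,\dots$ be i.i.d. real random variables with law $G$, let $p\ge2$ be an integer, and suppose that $\int x^{4p}\,dG(x)<\infty$, that $G$ is symmetric about some point, and that $G$ is nondegenerate. Put $$m_\ell=\int x^\ell\,dG(x),\quad m=m_1,\quad \mu_\ell=\int (x-m)^\ell\,dG(x),\quad \sigma=\sqrt{\mu_2}>0,\quad b_p=\frac{\mu_{2p-1}}{\sigma^{2p-1}},\quad a_p=\frac{\mu_{2p}}{\sigma^{2p}},$$ $$\overline X_n=\frac1n\sum_{i=1}^n X_i,\quad \mu_{n,\ell}=\frac1n\sum_{i=1}^n (X_i-\overline X_n)^\ell,\quad b_{n,p}=\frac{\mu_{n,2p-1}}{\mu_{n,2}^{(2p-1)/2}},\quad a_{n,p}=\frac{\mu_{n,2p}}{\mu_{n,2}^{p}}$$ (with $b_{n,p}=a_{n,p}=0$ on the event $\mu_{n,2}=0$, whose probability tends to $0$). With $h_q(x)=x^q$, let $$A(\ell)=h_\ell+\sum_{q=0}^{\ell-1}\binom{\ell}{q}(-1)^{\ell-q}\left(m^{\ell-q}h_q+(\ell-q)\,m^{\ell-q-1}m_q\,h_1\right)$$ (where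 $0^0=1$) and $$B(p)=\sigma^{-(2p-1)}\left(A(2p-1)-\tfrac12(2p-1)\sigma^{-2}\mu_{2p-1}A(2)\right),\qquad C(p)=\sigma^{-2p}\left(A(2p)-p\,\sigma^{-2}\mu_{2p}A(2)\right),$$ and let $bj(p)=\operatorname{Var}_G(B(p))$ and $aj(p)=\operatorname{Var}_G(C(p))$. Then, as $n\to\infty$, $$\sqrt n\,\bigl(b_{n,p}-b_p,\;a_{n,p}-a_p\bigr)\longrightarrow \mathcal N(0,bj(p))\otimes\mathcal N(0,aj(p))\quad\text{in law},$$ that is, the limit is a centred bivariate Gaussian with variances $bj(p)$, $aj(p)$ and zero covariance. If moreover $bj(p)\ne0$ and $aj(p)\ne0$, then $$n\left(\frac{b_{n,p}^2}{bj(p)}+\frac{(a_{n,p}-a_p)^2}{aj(p)}\right)\longrightarrow\chi^2_2\quad\text{in law}.$$ -/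

import Mathlib

open MeasureTheory ProbabilityTheory Filter

noncomputable section

namespace JBTest

/-- The chi-square distribution with `k` degrees of freedom: the law of `Z₁² + ⋯ + Z_k²` for
independent standard normal variables `Z₁, …, Z_k`. -/
def chiSquare (k : ℕ) : Measure ℝ :=
  (Measure.pi fun _ : Fin k => gaussianReal 0 1).map fun z => ∑ i, z i ^ 2

instance (k : ℕ) : IsProbabilityMeasure (chiSquare k) :=
  Measure.isProbabilityMeasure_map
    (Measurable.aemeasurable (by fun_prop))

/-- A law on the line is symmetric if it is invariant under the reflection `x ↦ 2c - x` about
some centre `c`. -/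
def IsSymmetric (G : Measure ℝ) : Prop :=
  ∃ c : ℝ, G.map (fun x => 2 * c - x) = G

section Population

variable (G : Measure ℝ)

/-- The moment `m_ℓ = ∫ x ^ ℓ dG(x)`. -/
def mom (l : ℕ) : ℝ := ∫ x, x ^ l ∂G

/-- The central moment `μ_ℓ = ∫ (x - m₁) ^ ℓ dG(x)`. -/
def cmom (l : ℕ) : ℝ := ∫ x, (x - mom G 1) ^ l ∂G

/-- The standard deviation `σ`, so that `σ² = μ₂`. -/
def sigma : ℝ := √(cmom G 2)

/-- `b_p = μ_{2p-1} / σ^{2p-1}`, for `p ≥ 1`. -/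
def bPop (p : ℕ) : ℝ := cmom G (2 * p - 1) / sigma G ^ (2 * p - 1)

/-- `a_p = μ_{2p} / σ^{2p}`. -/
def aPop (p : ℕ) : ℝ := cmom G (2 * p) / sigma G ^ (2 * p)

/-- The function
`A(ℓ) = h_ℓ + ∑_{q < ℓ} C(ℓ,q) (-1)^{ℓ-q} (m₁^{ℓ-q} h_q + (ℓ-q) m₁^{ℓ-q-1} m_q h₁)`,
where `h_q(x) = x^q`. -/
def A (l : ℕ) (x : ℝ) : ℝ :=
  x ^ l + ∑ q ∈ Finset.range l, (l.choose q : ℝ) * (-1) ^ (l - q) *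
    (mom G 1 ^ (l - q) * x ^ q + ((l : ℝ) - q) * mom G 1 ^ (l - q - 1) * mom G q * x)

/-- `B(p) = σ^{-(2p-1)} (A(2p-1) - ½ (2p-1) σ⁻² μ_{2p-1} A(2))`, for `p ≥ 1`. -/
def B (p : ℕ) (x : ℝ) : ℝ :=
  (sigma G ^ (2 * p - 1))⁻¹ * (A G (2 * p - 1) x -
    1 / 2 * (2 * (p : ℝ) - 1) * (sigma G ^ 2)⁻¹ * cmom G (2 * p - 1) * A G 2 x)

/-- `C(p) = σ^{-2p} (A(2p) - p σ⁻² μ_{2p} A(2))`. -/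
def C (p : ℕ) (x : ℝ) : ℝ :=
  (sigma G ^ (2 * p))⁻¹ * (A G (2 * p) x -
    (p : ℝ) * (sigma G ^ 2)⁻¹ * cmom G (2 * p) * A G 2 x)

/-- `bj(p) = Var(B(p)(X))` for `X` with law `G`. -/
def bj (p : ℕ) : ℝ := variance (B G p) G

/-- `aj(p) = Var(C(p)(X))` for `X` with law `G`. -/
def aj (p : ℕ) : ℝ := variance (C G p) G

end Population

section Sample

variable {Ω : Type*} (X : ℕ → Ω → ℝ)

/-- The mean of the first `n` observations `X 0, …, X (n - 1)`. -/
def sampleMean (n : ℕ) (ω : Ω) : ℝ := 1 / (n : ℝ) * ∑ i ∈ Finset.range n, X i ω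

/-- The centred empirical moment `μ_{n,ℓ}` of the first `n` observations. -/
def sampleCmom (n l : ℕ) (ω : Ω) : ℝ :=
  1 / (n : ℝ) * ∑ i ∈ Finset.range n, (X i ω - sampleMean X n ω) ^ l

/-- `b_{n,p} = μ_{n,2p-1} / μ_{n,2}^{(2p-1)/2}`, for `p ≥ 1`. -/
def bStat (n p : ℕ) (ω : Ω) : ℝ :=
  sampleCmom X n (2 * p - 1) ω / sampleCmom X n 2 ω ^ ((2 * (p : ℝ) - 1) / 2)

/-- `a_{n,p} = μ_{n,2p} / μ_{n,2}^p`. -/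
def aStat (n p : ℕ) (ω : Ω) : ℝ :=
  sampleCmom X n (2 * p) ω / sampleCmom X n 2 ω ^ p

end Sample

end JBTest

end

noncomputable section

namespace JBTest

open scoped Topology

/-! Write `S_l` for the empirical moment of order `l` about the true mean and `N_l` for the
normalized sum of `(x - m)^l`. Expanding around `m` gives `μ_{n,l} = S_l + K S_1` exactly, with `K →
-l μ_{l-1}` almost surely (`sampleCmom_eq`, `ae_tendsto_centringCoeff`). Hence `√n (μ_{n,l} - μ_l) =
N_l + K N_1`. The delta method for the division by a power of `μ_{n,2}` then makes each statistic,
up to `o_P(1)`, a normalized sum of one function of the observations (`tendstoInMeasure_bStat_sub`,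
`tendstoInMeasure_aStat_sub`). Every error is an almost surely null factor times a sum that
converges in law, so Slutsky disposes of it.

Symmetry kills the odd central moments. The two functions become `oddPart`, equal to `B p` up to a
constant, and `evenPart`, equal to `C p`. One is odd and the other even about the mean, so they are
uncorrelated, and the bivariate central limit theorem yields a product of Gaussians. The chi-square
limit follows by continuous mapping, since `b_p = 0`. -/

/-- The normalized centred sum `n^{-1/2} (∑_{k<n} f(X_k) - n ∫ f dG)`. -/
def normSum (G : Measure ℝ) {Ω : Type*} (X : ℕ → Ω → ℝ) (f : ℝ → ℝ) (n : ℕ) (ω : Ω) : ℝ :=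
  (√(n : ℝ))⁻¹ * (∑ k ∈ Finset.range n, f (X k ω) - n * ∫ x, f x ∂G)

lemma normSum_add_mul {G : Measure ℝ} {Ω : Type*} {X : ℕ → Ω → ℝ} {f g : ℝ → ℝ}
    (hf : Integrable f G) (hg : Integrable g G) (a b : ℝ) (n : ℕ) (ω : Ω) :
    normSum G X (fun x => a * f x + b * g x) n ω =
      a * normSum G X f n ω + b * normSum G X g n ω := by
  unfold normSum
  rw [integral_add (hf.const_mul a) (hg.const_mul b), integral_const_mul, integral_const_mul,
    Finset.sum_add_distrib, ← Finset.mul_sum, ← Finset.mul_sum]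
  ring

/-! ### Central limit theorem and Slutsky's lemma -/

section

variable {Ω : Type*} [MeasurableSpace Ω] {P : Measure Ω} [IsProbabilityMeasure P]
  {G : Measure ℝ} {X : ℕ → Ω → ℝ}

lemma tendstoInDistribution_normSum (hlaw : ∀ i, HasLaw (X i) G P) (hindep : iIndepFun X P)
    {f : ℝ → ℝ} (hf : Measurable f) (hf2 : MemLp f 2 G) :
    TendstoInDistribution (normSum G X f) atTop (id : ℝ → ℝ) (fun _ => P)
      (gaussianReal 0 (variance f G).toNNReal) := by
  have hid (i : ℕ) : IdentDistrib (X i) (X 0) P P :=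
    ⟨(hlaw i).aemeasurable, (hlaw 0).aemeasurable, by rw [(hlaw i).map_eq, (hlaw 0).map_eq]⟩
  have hvar : variance (f ∘ X 0) P = variance f G := by
    rw [← (hlaw 0).map_eq, variance_map (by fun_prop) (hlaw 0).aemeasurable]
  have hint : ∫ ω, (f ∘ X 0) ω ∂P = ∫ x, f x ∂G :=
    (hlaw 0).integral_comp hf.aestronglyMeasurable
  have hmem : MemLp (f ∘ X 0) 2 P := by
    rw [← (hlaw 0).map_eq] at hf2
    exact hf2.comp_of_map (hlaw 0).aemeasurable
  have h := tendstoInDistribution_inv_sqrt_mul_sum_sub (X := fun i => f ∘ X i) (P := P)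
    (P' := gaussianReal 0 (variance f G).toNNReal) (Y := id)
    (by rw [hvar]; exact HasLaw.id) hmem
    (hindep.comp (fun _ => f) (fun _ => hf)) (fun i => (hid i).comp hf)
  rw [hint] at h
  exact h

lemma variance_add_mul_of_covariance_eq_zero [IsFiniteMeasure G] {f g : ℝ → ℝ}
    (hf : MemLp f 2 G) (hg : MemLp g 2 G)
    (hfg : covariance f g G = 0) (a b : ℝ) :
    variance (fun x => a * f x + b * g x) G = a ^ 2 * variance f G + b ^ 2 * variance g G := by
  rw [variance_fun_add (hf.const_mul a) (hg.const_mul b), covariance_const_mul_left,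
    covariance_const_mul_right, hfg, variance_const_mul, variance_const_mul]
  ring

/-- Bivariate central limit theorem for uncorrelated square-integrable functions. -/
lemma tendstoInDistribution_normSum_prodMk [IsProbabilityMeasure G]
    (hlaw : ∀ i, HasLaw (X i) G P) (hindep : iIndepFun X P)
    {f g : ℝ → ℝ} (hf : Measurable f) (hf2 : MemLp f 2 G) (hg : Measurable g) (hg2 : MemLp g 2 G)
    (hfg : covariance f g G = 0) :
    TendstoInDistribution (fun n ω => (normSum G X f n ω, normSum G X g n ω)) atTop
      (id : ℝ × ℝ → ℝ × ℝ) (fun _ => P)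
      ((gaussianReal 0 (variance f G).toNNReal).prod
        (gaussianReal 0 (variance g G).toNNReal)) := by
  set ν := (gaussianReal 0 (variance f G).toNNReal).prod (gaussianReal 0 (variance g G).toNNReal)
  have hmf := (tendstoInDistribution_normSum hlaw hindep hf hf2).forall_aemeasurable
  have hmg := (tendstoInDistribution_normSum hlaw hindep hg hg2).forall_aemeasurable
  have hmW (n : ℕ) : AEMeasurable
      (fun ω => WithLp.toLp 2 (normSum G X f n ω, normSum G X g n ω)) P :=
    (WithLp.measurable_toLp 2 (ℝ × ℝ)).comp_aemeasurable ((hmf n).prodMk (hmg n))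
  -- Lévy's continuity theorem needs an inner product space, hence the passage from `ℝ × ℝ` with its
  -- sup norm to `WithLp 2`.
  have key : TendstoInDistribution
      (fun n ω => WithLp.toLp 2 (normSum G X f n ω, normSum G X g n ω)) atTop
      (WithLp.toLp 2 : ℝ × ℝ → WithLp 2 (ℝ × ℝ)) (fun _ => P) ν := by
    refine ⟨hmW, (WithLp.measurable_toLp 2 (ℝ × ℝ)).aemeasurable, ?_⟩
    refine ProbabilityMeasure.tendsto_iff_tendsto_charFun.2 fun t => ?_
    obtain ⟨a, b⟩ := t
    -- Cramér–Wold: the characteristic function of the pair at `(a, b)` is that of the normalized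
    -- sum of `a f + b g` at `1`.
    have hlin := ProbabilityMeasure.tendsto_iff_tendsto_charFun.1
      (tendstoInDistribution_normSum hlaw hindep
        (f := fun x => a * f x + b * g x) (by fun_prop)
        ((hf2.const_mul a).add (hg2.const_mul b))).tendsto 1
    simp only [ProbabilityMeasure.coe_mk, Measure.map_id, charFun_gaussianReal] at hlin
    rw [variance_add_mul_of_covariance_eq_zero hf2 hg2 hfg] at hlin
    simp only [ProbabilityMeasure.coe_mk]
    convert! hlin using 2 with n
    · rw [charFun_apply, charFun_apply, integral_map (hmW n) (by fun_prop),
        integral_map ((tendstoInDistribution_normSum hlaw hindep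
          (f := fun x => a * f x + b * g x) (by fun_prop)
          ((hf2.const_mul a).add (hg2.const_mul b))).forall_aemeasurable n) (by fun_prop)]
      congr with ω
      rw [normSum_add_mul (hf2.integrable one_le_two) (hg2.integrable one_le_two)]
      simp [WithLp.prod_inner_apply]
    · rw [charFun_prod, charFun_gaussianReal, charFun_gaussianReal, ← Complex.exp_add]
      have h1 := variance_nonneg f G
      have h2 := variance_nonneg g G
      have h3 : 0 ≤ a ^ 2 * variance f G + b ^ 2 * variance g G := by positivity
      simp only [Real.coe_toNNReal _ h1, Real.coe_toNNReal _ h2, Real.coe_toNNReal _ h3]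
      push_cast
      ring_nf
  exact key.continuous_comp (g := WithLp.ofLp) (WithLp.prod_continuous_ofLp 2 ℝ ℝ)

/-- By Slutsky the product converges in law to `0 * T = 0`. A constant limit in law is a limit in
probability: apply the portmanteau theorem to the closed set `ε ≤ ‖x‖`, whose frontier misses `0`.
-/
lemma tendstoInMeasure_zero_mul {Ω' : Type*} [MeasurableSpace Ω'] {P' : Measure Ω'}
    [IsProbabilityMeasure P'] {Z Y : ℕ → Ω → ℝ} {T : Ω' → ℝ}
    (hZ : TendstoInDistribution Z atTop T (fun _ => P) P')
    (hY : ∀ n, AEMeasurable (Y n) P) (hY0 : ∀ᵐ ω ∂P, Tendsto (fun n => Y n ω) atTop (𝓝 0)) :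
    TendstoInMeasure P (fun n ω => Y n ω * Z n ω) atTop (fun _ => 0) := by
  have hYm : TendstoInMeasure P Y atTop (fun _ => 0) :=
    tendstoInMeasure_of_tendsto_ae (fun n => (hY n).aestronglyMeasurable) hY0
  have h := hZ.continuous_comp_prodMk_of_tendstoInMeasure_const
    (g := fun z : ℝ × ℝ => z.2 * z.1) (by fun_prop) hYm hY
  rw [tendstoInMeasure_iff_norm]
  intro ε hε
  have hcl : IsClosed {x : ℝ | ε ≤ ‖x‖} := isClosed_le continuous_const continuous_norm
  have hlim := ProbabilityMeasure.tendsto_measure_of_null_frontier_of_tendsto' h.tendsto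
    (E := {x : ℝ | ε ≤ ‖x‖}) (by
      simp only [zero_mul, ProbabilityMeasure.coe_mk, Measure.map_const, measure_univ, one_smul]
      rw [Measure.dirac_apply' _ isClosed_frontier.measurableSet]
      refine Set.indicator_of_notMem (fun h0 => ?_) _
      have := hcl.frontier_subset h0
      simp at this
      linarith)
  simp only [zero_mul, ProbabilityMeasure.coe_mk, Measure.map_const, measure_univ,
    one_smul] at hlim
  rw [Measure.dirac_apply' _ hcl.measurableSet, Set.indicator_of_notMem (by simpa using hε)] at hlim
  refine hlim.congr fun n => ?_
  rw [Measure.map_apply_of_aemeasurable (h.forall_aemeasurable n) hcl.measurableSet]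
  simp

end

/-! ### Symmetry and the influence functions -/

section

variable {G : Measure ℝ}

lemma memLp_sub_of_integrable_pow [IsProbabilityMeasure G] {k : ℕ}
    (hmom : Integrable (fun x : ℝ => x ^ (2 * k)) G)
    (c : ℝ) : MemLp (fun x => x - c) (2 * k : ℕ) G := by
  obtain rfl | hk := Nat.eq_zero_or_pos k
  · simpa [memLp_zero_iff_aestronglyMeasurable] using
      (measurable_id.sub_const c).aestronglyMeasurable
  have h : MemLp (fun x : ℝ => x) (2 * k : ℕ) G := by
    rw [← integrable_norm_rpow_iff (by fun_prop) (by norm_cast; lia) (ENNReal.natCast_ne_top _)]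
    refine hmom.congr (ae_of_all _ fun x => ?_)
    simp only [ENNReal.toReal_natCast, Real.rpow_natCast, Real.norm_eq_abs]
    rw [(even_two_mul k).pow_abs]
  exact h.sub (memLp_const c)

lemma integrable_sub_pow [IsProbabilityMeasure G] {k : ℕ}
    (hmom : Integrable (fun x : ℝ => x ^ (2 * k)) G) (c : ℝ)
    {j : ℕ} (hj : j ≤ 2 * k) : Integrable (fun x => (x - c) ^ j) G := by
  have h := ((memLp_sub_of_integrable_pow hmom c).mono_exponent
    (p := (j : ℕ)) (by exact_mod_cast hj)).integrable_norm_pow'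
  refine (integrable_norm_iff (by fun_prop)).1 ?_
  simpa only [norm_pow] using h

lemma memLp_two_sub_pow [IsProbabilityMeasure G] {k : ℕ}
    (hmom : Integrable (fun x : ℝ => x ^ (2 * k)) G) (c : ℝ)
    {j : ℕ} (hj : j ≤ k) : MemLp (fun x => (x - c) ^ j) 2 G := by
  rw [memLp_two_iff_integrable_sq (by fun_prop)]
  simp_rw [← pow_mul]
  exact integrable_sub_pow hmom c (by lia)

lemma cmom_eq_sum {k : ℕ} (hint : ∀ q ≤ k, Integrable (fun x : ℝ => x ^ q) G) :
    cmom G k = ∑ q ∈ Finset.range (k + 1), mom G q * (-mom G 1) ^ (k - q) * (k.choose q : ℝ) := by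
  unfold cmom
  simp_rw [sub_eq_add_neg, add_pow]
  rw [integral_finsetSum _ fun q hq => ((hint q (by simp at hq; lia)).mul_const _).mul_const _]
  simp_rw [integral_mul_const]
  rfl

/-- The `h_q` terms rebuild the binomial expansion of `(x - m)^(k+1)`. The `h_1` terms sum to
`-(k+1) μ_k x` because `C(k+1,q) (k+1-q) = (k+1) C(k,q)`. -/
lemma A_succ_eq {k : ℕ} (hint : ∀ q ≤ k, Integrable (fun x : ℝ => x ^ q) G) (x : ℝ) :
    A G (k + 1) x = (x - mom G 1) ^ (k + 1) - (k + 1) * cmom G k * x := by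
  rw [cmom_eq_sum hint, sub_eq_add_neg x, add_pow, Finset.sum_range_succ, A, Finset.mul_sum,
    Finset.sum_mul]
  simp only [Nat.sub_self, pow_zero, Nat.choose_self, Nat.cast_one, mul_one]
  rw [add_comm (x ^ (k + 1)), add_sub_right_comm, ← Finset.sum_sub_distrib]
  congr 1
  refine Finset.sum_congr rfl fun q hq => ?_
  have hq' : q ≤ k := by simp at hq; lia
  obtain ⟨r, rfl⟩ := Nat.exists_eq_add_of_le hq'
  have h1 : q + r + 1 - q = r + 1 := by lia
  have h2 : q + r - q = r := by lia
  have hch : ((q + r).choose q : ℝ) * (q + r + 1) = ((q + r + 1).choose q : ℝ) * (r + 1) := by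
    have := Nat.choose_mul_succ_eq (q + r) q
    rw [h1] at this
    exact_mod_cast this
  rw [h1, h2, Nat.add_sub_cancel, neg_pow (mom G 1) (r + 1), neg_pow (mom G 1) r]
  push_cast
  linear_combination (mom G q * (-1) ^ r * mom G 1 ^ r * x) * hch

lemma integral_reflect {c : ℝ} (hc : G.map (fun x => 2 * c - x) = G) {f : ℝ → ℝ}
    (hf : Measurable f) : ∫ x, f (2 * c - x) ∂G = ∫ x, f x ∂G := by
  conv_rhs => rw [← hc]
  rw [integral_map (by fun_prop) hf.aestronglyMeasurable]

/-- Integrating `2c - x` against the invariant law forces the centre `c` to be the mean. -/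
lemma map_reflect_mom_one [IsProbabilityMeasure G] (hsymm : IsSymmetric G)
    (hint : Integrable (fun x : ℝ => x) G) :
    G.map (fun x => 2 * mom G 1 - x) = G := by
  obtain ⟨c, hc⟩ := hsymm
  have h := integral_reflect hc measurable_id
  simp only [id] at h
  rw [integral_sub (integrable_const _) hint] at h
  have : mom G 1 = c := by simp [mom] at h ⊢; linarith
  rwa [this]

lemma integral_eq_zero_of_odd_about_mean [IsProbabilityMeasure G] (hsymm : IsSymmetric G)
    (hint : Integrable (fun x : ℝ => x) G) {f : ℝ → ℝ} (hf : Measurable f)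
    (hodd : ∀ x, f (2 * mom G 1 - x) = -f x) : ∫ x, f x ∂G = 0 := by
  have h := integral_reflect (map_reflect_mom_one hsymm hint) hf
  simp_rw [hodd, integral_neg] at h
  linarith

lemma reflect_sub_pow (m x : ℝ) (k : ℕ) : (2 * m - x - m) ^ k = (-1) ^ k * (x - m) ^ k := by
  rw [← mul_pow]; ring_nf

lemma cmom_eq_zero_of_odd [IsProbabilityMeasure G] (hsymm : IsSymmetric G)
    (hint : Integrable (fun x : ℝ => x) G)
    {k : ℕ} (hk : Odd k) : cmom G k = 0 := by
  refine integral_eq_zero_of_odd_about_mean hsymm hint (by fun_prop) fun x => ?_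
  rw [reflect_sub_pow, hk.neg_one_pow]
  ring

lemma sq_sigma (hσ : 0 < sigma G) : sigma G ^ 2 = cmom G 2 :=
  Real.sq_sqrt (Real.sqrt_pos.1 hσ).le

/-- The part of `B p` that is odd about the mean. -/
def oddPart (G : Measure ℝ) (p : ℕ) (x : ℝ) : ℝ :=
  (sigma G ^ (2 * p - 1))⁻¹ *
    ((x - mom G 1) ^ (2 * p - 1) - (2 * p - 1) * cmom G (2 * p - 2) * (x - mom G 1))

/-- The form of `C p` for laws whose odd central moments vanish. -/
def evenPart (G : Measure ℝ) (p : ℕ) (x : ℝ) : ℝ :=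
  (sigma G ^ (2 * p))⁻¹ *
    ((x - mom G 1) ^ (2 * p) - p * (sigma G ^ 2)⁻¹ * cmom G (2 * p) * (x - mom G 1) ^ 2)

variable {p : ℕ}

/-- The `A 2` term carries the factor `μ_{2p-1} = 0`. The constant arises because `A` has `x` where
`oddPart` has `x - m`; it does not affect the variance. -/
lemma B_eq [IsProbabilityMeasure G] (hp : 1 ≤ p) (hsymm : IsSymmetric G)
    (hint : ∀ q ≤ 2 * p, Integrable (fun x : ℝ => x ^ q) G) (x : ℝ) :
    B G p x = oddPart G p x -
      (sigma G ^ (2 * p - 1))⁻¹ * ((2 * p - 1) * cmom G (2 * p - 2) * mom G 1) := by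
  have hint1 : Integrable (fun x : ℝ => x) G := by simpa using hint 1 (by lia)
  rw [B, oddPart, cmom_eq_zero_of_odd hsymm hint1 (k := 2 * p - 1) ⟨p - 1, by lia⟩]
  obtain ⟨r, rfl⟩ := Nat.exists_eq_add_of_le' hp
  rw [show 2 * (r + 1) - 1 = 2 * r + 1 by lia, show 2 * (r + 1) - 2 = 2 * r by lia,
    A_succ_eq fun q hq => hint q (by lia)]
  push_cast
  ring

/-- The linear terms of `A (2p)` and `A 2` carry `μ_{2p-1}` and `μ_1`, both zero. -/
lemma C_eq [IsProbabilityMeasure G] (hp : 1 ≤ p) (hsymm : IsSymmetric G)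
    (hint : ∀ q ≤ 2 * p, Integrable (fun x : ℝ => x ^ q) G) : C G p = evenPart G p := by
  have hint1 : Integrable (fun x : ℝ => x) G := by simpa using hint 1 (by lia)
  ext x
  rw [C, evenPart]
  obtain ⟨r, rfl⟩ := Nat.exists_eq_add_of_le' hp
  rw [show 2 * (r + 1) = 2 * r + 1 + 1 by lia, A_succ_eq fun q hq => hint q (by lia),
    show (2 : ℕ) = 1 + 1 from rfl, A_succ_eq fun q hq => hint q (by lia),
    cmom_eq_zero_of_odd hsymm hint1 (k := (1 + 1) * r + 1) ⟨r, by lia⟩,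
    cmom_eq_zero_of_odd hsymm hint1 (k := 1) ⟨0, rfl⟩]
  ring

lemma measurable_oddPart : Measurable (oddPart G p) := by unfold oddPart; fun_prop

lemma measurable_evenPart : Measurable (evenPart G p) := by unfold evenPart; fun_prop

lemma memLp_oddPart [IsProbabilityMeasure G] (hp : 1 ≤ p)
    (hmom : Integrable (fun x : ℝ => x ^ (2 * (2 * p))) G) :
    MemLp (oddPart G p) 2 G := by
  have h1 := memLp_two_sub_pow hmom (mom G 1) (j := 1) (by lia)
  simp only [pow_one] at h1
  exact ((memLp_two_sub_pow hmom (mom G 1) (by lia)).sub (h1.const_mul _)).const_mul _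

lemma memLp_evenPart [IsProbabilityMeasure G] (hp : 1 ≤ p)
    (hmom : Integrable (fun x : ℝ => x ^ (2 * (2 * p))) G) :
    MemLp (evenPart G p) 2 G :=
  ((memLp_two_sub_pow hmom (mom G 1) le_rfl).sub
    ((memLp_two_sub_pow hmom (mom G 1) (by lia)).const_mul _)).const_mul _

lemma oddPart_reflect (hp : 1 ≤ p) (x : ℝ) :
    oddPart G p (2 * mom G 1 - x) = -oddPart G p x := by
  rw [oddPart, reflect_sub_pow, Odd.neg_one_pow ⟨p - 1, by lia⟩, oddPart]
  ring

lemma evenPart_reflect (x : ℝ) : evenPart G p (2 * mom G 1 - x) = evenPart G p x := by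
  rw [evenPart, reflect_sub_pow, reflect_sub_pow, (even_two_mul p).neg_one_pow, evenPart]
  ring

/-- Odd times even is odd about the mean, so both the product and `oddPart` integrate to zero. This
is the source of the independence in the limit. -/
lemma covariance_oddPart_evenPart [IsProbabilityMeasure G] (hp : 1 ≤ p) (hsymm : IsSymmetric G)
    (hmom : Integrable (fun x : ℝ => x ^ (2 * (2 * p))) G) :
    covariance (oddPart G p) (evenPart G p) G = 0 := by
  have hint1 : Integrable (fun x : ℝ => x) G := by
    simpa using integrable_sub_pow hmom 0 (j := 1) (by lia)
  rw [covariance_eq_sub (memLp_oddPart hp hmom) (memLp_evenPart hp hmom),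
    integral_eq_zero_of_odd_about_mean hsymm hint1 measurable_oddPart (oddPart_reflect hp),
    integral_eq_zero_of_odd_about_mean hsymm hint1 (measurable_oddPart.mul measurable_evenPart)
      fun x => by simp [oddPart_reflect hp, evenPart_reflect]]
  simp

lemma variance_oddPart [IsProbabilityMeasure G] (hp : 1 ≤ p) (hsymm : IsSymmetric G)
    (hint : ∀ q ≤ 2 * p, Integrable (fun x : ℝ => x ^ q) G) :
    variance (oddPart G p) G = bj G p := by
  rw [bj, funext (B_eq hp hsymm hint), variance_sub_const
    measurable_oddPart.aestronglyMeasurable]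

lemma variance_evenPart [IsProbabilityMeasure G] (hp : 1 ≤ p) (hsymm : IsSymmetric G)
    (hint : ∀ q ≤ 2 * p, Integrable (fun x : ℝ => x ^ q) G) :
    variance (evenPart G p) G = aj G p := by
  rw [aj, C_eq hp hsymm hint]

end

/-- Union bound: `ε ≤ ‖W‖` forces `ε / 2 ≤ ‖U‖` or `ε / 2 ≤ ‖V‖`. The general target `E` serves both
sums and pairs. -/
lemma tendstoInMeasure_zero_of_norm_le_add {Ω E : Type*} [MeasurableSpace Ω] {P : Measure Ω}
    [SeminormedAddCommGroup E] {U V : ℕ → Ω → ℝ} {W : ℕ → Ω → E}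
    (hU : TendstoInMeasure P U atTop (fun _ => 0)) (hV : TendstoInMeasure P V atTop (fun _ => 0))
    (h : ∀ n ω, ‖W n ω‖ ≤ ‖U n ω‖ + ‖V n ω‖) : TendstoInMeasure P W atTop (fun _ => 0) := by
  rw [tendstoInMeasure_iff_norm] at hU hV ⊢
  intro ε hε
  refine tendsto_of_tendsto_of_tendsto_of_le_of_le tendsto_const_nhds
    (by simpa using (hU (ε / 2) (by positivity)).add (hV (ε / 2) (by positivity)))
    (fun _ => zero_le) fun n => ?_
  refine (measure_mono fun ω hω => ?_).trans (measure_union_le _ _)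
  simp only [sub_zero, Set.mem_ofPred_eq, Set.mem_union] at hω ⊢
  have := h n ω
  rw [← not_lt, ← not_lt, ← not_and_or]
  rintro ⟨h1, h2⟩
  simp only [← Real.norm_eq_abs] at h1 h2
  linarith

lemma tendstoInMeasure_zero_add {Ω : Type*} [MeasurableSpace Ω] {P : Measure Ω}
    {U V : ℕ → Ω → ℝ}
    (hU : TendstoInMeasure P U atTop (fun _ => 0)) (hV : TendstoInMeasure P V atTop (fun _ => 0)) :
    TendstoInMeasure P (fun n ω => U n ω + V n ω) atTop (fun _ => 0) :=
  tendstoInMeasure_zero_of_norm_le_add hU hV fun _ _ => norm_add_le _ _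

/-- The empirical moment of order `l` about the population mean. -/
def popCentredMoment (G : Measure ℝ) {Ω : Type*} (X : ℕ → Ω → ℝ) (l n : ℕ) (ω : Ω) : ℝ :=
  (∑ i ∈ Finset.range n, (X i ω - mom G 1) ^ l) / n

/-- The coefficient `K` in the expansion `μ_{n,l} = S_l + K S_1`, where `S_l` is the empirical
moment of order `l` about the population mean. -/
def centringCoeff (G : Measure ℝ) {Ω : Type*} (X : ℕ → Ω → ℝ) (l n : ℕ) (ω : Ω) : ℝ :=
  -∑ q ∈ Finset.range l, (-popCentredMoment G X 1 n ω) ^ (l - 1 - q) *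
    (l.choose q : ℝ) * popCentredMoment G X q n ω

/-! ### Exact expansion of the empirical central moments -/

section Algebra

variable {G : Measure ℝ} {Ω : Type*} {X : ℕ → Ω → ℝ}

lemma sampleMean_eq {n : ℕ} (hn : n ≠ 0) (ω : Ω) :
    sampleMean X n ω = popCentredMoment G X 1 n ω + mom G 1 := by
  have : (n : ℝ) ≠ 0 := by exact_mod_cast hn
  simp only [sampleMean, popCentredMoment, pow_one, Finset.sum_sub_distrib, Finset.sum_const,
    Finset.card_range, nsmul_eq_mul]
  field_simp
  ring

/-- In the binomial expansion of `((X i - m) - S_1)^l`, every term except the top power of `X i - m`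
contains a factor `S_1`. -/
lemma sampleCmom_eq {n : ℕ} (hn : n ≠ 0) {l : ℕ} (hl : l ≠ 0) (ω : Ω) :
    sampleCmom X n l ω =
      popCentredMoment G X l n ω + centringCoeff G X l n ω * popCentredMoment G X 1 n ω := by
  obtain ⟨k, rfl⟩ := Nat.exists_eq_succ_of_ne_zero hl
  have h (i : ℕ) : (X i ω - sampleMean X n ω) ^ (k + 1) = (X i ω - mom G 1) ^ (k + 1) -
      (∑ q ∈ Finset.range (k + 1), (-popCentredMoment G X 1 n ω) ^ (k - q) *
        ((k + 1).choose q : ℝ) * (X i ω - mom G 1) ^ q) * popCentredMoment G X 1 n ω := by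
    rw [sampleMean_eq (G := G) hn, ← sub_sub, sub_right_comm, sub_eq_add_neg _
      (popCentredMoment G X 1 n ω), add_pow, Finset.sum_range_succ, Finset.sum_mul]
    simp only [Nat.sub_self, pow_zero, Nat.choose_self, Nat.cast_one, mul_one]
    rw [add_comm, sub_eq_add_neg ((X i ω - mom G 1) ^ (k + 1)), ← Finset.sum_neg_distrib]
    congr 1
    refine Finset.sum_congr rfl fun q hq => ?_
    rw [show k + 1 - q = k - q + 1 by simp at hq; lia, pow_succ]
    ring
  simp only [sampleCmom, h, Finset.sum_sub_distrib, ← Finset.sum_mul]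
  rw [Finset.sum_comm]
  simp only [← Finset.mul_sum, centringCoeff, Nat.succ_eq_add_one, Nat.add_sub_cancel]
  rw [mul_sub, ← mul_assoc, neg_mul, ← sub_eq_add_neg]
  congr 1
  · rw [popCentredMoment, one_div_mul_eq_div]
  · rw [Finset.mul_sum]
    congr 1
    refine Finset.sum_congr rfl fun q _ => ?_
    rw [popCentredMoment.eq_def G X q, one_div]
    ring

lemma sqrt_mul_popCentredMoment (n l : ℕ) (ω : Ω) :
    √(n : ℝ) * (popCentredMoment G X l n ω - cmom G l) =
      normSum G X (fun x => (x - mom G 1) ^ l) n ω := by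
  obtain rfl | hn := Nat.eq_zero_or_pos n
  · simp [normSum]
  have h0 : 0 < √(n : ℝ) := by positivity
  have h2 : √(n : ℝ) ^ 2 = n := Real.sq_sqrt (by positivity)
  have hn' : (n : ℝ) ≠ 0 := by positivity
  rw [popCentredMoment, normSum, cmom]
  field_simp
  rw [h2]

lemma sqrt_mul_sampleCmom {n : ℕ} (hn : n ≠ 0) {l : ℕ} (hl : l ≠ 0) (h1 : cmom G 1 = 0) (ω : Ω) :
    √(n : ℝ) * (sampleCmom X n l ω - cmom G l) =
      normSum G X (fun x => (x - mom G 1) ^ l) n ω +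
        centringCoeff G X l n ω * normSum G X (fun x => (x - mom G 1) ^ 1) n ω := by
  rw [← sqrt_mul_popCentredMoment, ← sqrt_mul_popCentredMoment, h1,
    sampleCmom_eq (G := G) hn hl]
  ring

end Algebra

/-! ### Almost sure limits and linearization of the statistics -/

section Limits

variable {Ω : Type*} [MeasurableSpace Ω] {P : Measure Ω} {G : Measure ℝ} {X : ℕ → Ω → ℝ}

lemma ae_tendsto_popCentredMoment [IsProbabilityMeasure P] (hlaw : ∀ i, HasLaw (X i) G P)
    (hindep : iIndepFun X P)
    {l : ℕ} (hint : Integrable (fun x => (x - mom G 1) ^ l) G) :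
    ∀ᵐ ω ∂P, Tendsto (fun n => popCentredMoment G X l n ω) atTop (𝓝 (cmom G l)) := by
  have hm : Measurable fun x : ℝ => (x - mom G 1) ^ l := by fun_prop
  have hid (i : ℕ) : IdentDistrib (X i) (X 0) P P :=
    ⟨(hlaw i).aemeasurable, (hlaw 0).aemeasurable, by rw [(hlaw i).map_eq, (hlaw 0).map_eq]⟩
  have h := strong_law_ae_real (fun i => (fun x => (x - mom G 1) ^ l) ∘ X i) (μ := P) (by
      exact ((hlaw 0).map_eq.symm ▸ hint :
        Integrable (fun x => (x - mom G 1) ^ l) (P.map (X 0))).comp_aemeasurable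
          (hlaw 0).aemeasurable)
    (fun i j hij => (hindep.indepFun hij).comp hm hm) (fun i => (hid i).comp hm)
  rw [(hlaw 0).integral_comp hm.aestronglyMeasurable] at h
  exact h

lemma ae_tendsto_centringCoeff [IsProbabilityMeasure P] (hlaw : ∀ i, HasLaw (X i) G P)
    (hindep : iIndepFun X P)
    {k : ℕ} (hint : ∀ q ≤ k + 1, Integrable (fun x => (x - mom G 1) ^ q) G) (h1 : cmom G 1 = 0) :
    ∀ᵐ ω ∂P, Tendsto (fun n => centringCoeff G X (k + 1) n ω) atTop
      (𝓝 (-((k + 1) * cmom G k))) := by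
  have hall : ∀ᵐ ω ∂P, ∀ q : ℕ, q ≤ k + 1 →
      Tendsto (fun n => popCentredMoment G X q n ω) atTop (𝓝 (cmom G q)) := by
    rw [ae_all_iff]
    intro q
    by_cases hq : q ≤ k + 1
    · filter_upwards [ae_tendsto_popCentredMoment hlaw hindep (hint q hq)] with ω hω _ using hω
    · exact ae_of_all _ fun _ h => absurd h hq
  filter_upwards [hall] with ω hω
  have hlim := (tendsto_finsetSum (Finset.range (k + 1)) fun q hq =>
    (((hω 1 (by lia)).neg.pow (k + 1 - 1 - q)).mul_const ((k + 1).choose q : ℝ)).mul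
      (hω q (by simp at hq; lia))).neg
  unfold centringCoeff
  convert! hlim using 2
  -- As `S_1 → 0`, only the term `q = k` survives, where the power of `S_1` has exponent zero.
  rw [h1, Finset.sum_range_succ, Finset.sum_eq_zero fun q hq => ?_]
  · simp
  · rw [neg_zero, zero_pow (by simp at hq; lia)]
    simp

lemma ae_tendsto_sampleCmom [IsProbabilityMeasure P] (hlaw : ∀ i, HasLaw (X i) G P)
    (hindep : iIndepFun X P)
    {l : ℕ} (hl : l ≠ 0) (hint : ∀ q ≤ l, Integrable (fun x => (x - mom G 1) ^ q) G)
    (h1 : cmom G 1 = 0) :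
    ∀ᵐ ω ∂P, Tendsto (fun n => sampleCmom X n l ω) atTop (𝓝 (cmom G l)) := by
  obtain ⟨k, rfl⟩ := Nat.exists_eq_succ_of_ne_zero hl
  filter_upwards [ae_tendsto_popCentredMoment hlaw hindep (hint _ le_rfl),
    ae_tendsto_centringCoeff hlaw hindep hint h1,
    ae_tendsto_popCentredMoment hlaw hindep (hint 1 (by lia))] with ω ha hb hc
  have h := ha.add (hb.mul hc)
  rw [h1, mul_zero, add_zero] at h
  refine h.congr' ?_
  filter_upwards [eventually_ne_atTop 0] with n hn
  rw [sampleCmom_eq (G := G) hn hl]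

lemma aemeasurable_popCentredMoment (hX : ∀ i, AEMeasurable (X i) P) (l n : ℕ) :
    AEMeasurable (popCentredMoment G X l n) P := by
  unfold popCentredMoment; fun_prop

lemma aemeasurable_centringCoeff (hX : ∀ i, AEMeasurable (X i) P) (l n : ℕ) :
    AEMeasurable (centringCoeff G X l n) P := by
  have := aemeasurable_popCentredMoment (G := G) hX
  unfold centringCoeff; fun_prop

lemma aemeasurable_sampleCmom (hX : ∀ i, AEMeasurable (X i) P) (l n : ℕ) :
    AEMeasurable (sampleCmom X n l) P := by
  unfold sampleCmom sampleMean; fun_prop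

lemma aemeasurable_bStat (hX : ∀ i, AEMeasurable (X i) P) (p n : ℕ) :
    AEMeasurable (bStat X n p) P := by
  have := aemeasurable_sampleCmom hX
  unfold bStat; fun_prop

lemma aemeasurable_aStat (hX : ∀ i, AEMeasurable (X i) P) (p n : ℕ) :
    AEMeasurable (aStat X n p) P := by
  have := aemeasurable_sampleCmom hX
  unfold aStat; fun_prop

/-- An almost surely null sequence times the normalized sum of a power tends to `0` in
probability. -/
lemma tendstoInMeasure_zero_mul_normSum [IsProbabilityMeasure P] [IsProbabilityMeasure G]
    (hlaw : ∀ i, HasLaw (X i) G P) (hindep : iIndepFun X P)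
    {k j : ℕ} (hmom : Integrable (fun x : ℝ => x ^ (2 * k)) G) (hj : j ≤ k) {Y : ℕ → Ω → ℝ}
    (hY : ∀ n, AEMeasurable (Y n) P) (hY0 : ∀ᵐ ω ∂P, Tendsto (fun n => Y n ω) atTop (𝓝 0)) :
    TendstoInMeasure P (fun n ω => Y n ω * normSum G X (fun x => (x - mom G 1) ^ j) n ω) atTop
      (fun _ => 0) :=
  tendstoInMeasure_zero_mul
    (tendstoInDistribution_normSum hlaw hindep (by fun_prop) (memLp_two_sub_pow hmom _ hj)) hY hY0

variable {p : ℕ}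

lemma sigma_pow_eq_rpow (hσ : 0 < sigma G) (hp : 1 ≤ p) :
    sigma G ^ (2 * p - 1) = cmom G 2 ^ ((2 * (p : ℝ) - 1) / 2) := by
  rw [← sq_sigma hσ, ← Real.rpow_natCast, ← Real.rpow_natCast, ← Real.rpow_mul hσ.le]
  congr 1
  rw [Nat.cast_sub (by lia)]
  push_cast
  ring

/-- Since `μ_{2p-1} = 0`, the numerator is already centred, so the denominator only has to be
consistent; its fluctuations do not enter. -/
lemma tendstoInMeasure_bStat_sub [IsProbabilityMeasure P] [IsProbabilityMeasure G]
    (hlaw : ∀ i, HasLaw (X i) G P) (hindep : iIndepFun X P)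
    (hsymm : IsSymmetric G) (hp : 1 ≤ p)
    (hmom : Integrable (fun x : ℝ => x ^ (2 * (2 * p))) G) (hσ : 0 < sigma G) :
    TendstoInMeasure P
      (fun (n : ℕ) ω => √(n : ℝ) * (bStat X n p ω - bPop G p) - normSum G X (oddPart G p) n ω)
      atTop (fun _ => 0) := by
  have hX (i : ℕ) := (hlaw i).aemeasurable
  have hint1 : Integrable (fun x : ℝ => x) G := by
    simpa using integrable_sub_pow hmom 0 (j := 1) (by lia)
  have hc1 := cmom_eq_zero_of_odd hsymm hint1 (k := 1) ⟨0, rfl⟩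
  have hcodd := cmom_eq_zero_of_odd hsymm hint1 (k := 2 * p - 1) ⟨p - 1, by lia⟩
  have hint (q : ℕ) (hq : q ≤ 2 * p) := integrable_sub_pow hmom (mom G 1) (j := q) (by lia)
  have hc2 : 0 < cmom G 2 := by rw [← sq_sigma hσ]; positivity
  set D : ℕ → Ω → ℝ := fun n ω => (sampleCmom X n 2 ω ^ ((2 * (p : ℝ) - 1) / 2))⁻¹ with hD
  have hDm (n : ℕ) : AEMeasurable (D n) P := by
    have := aemeasurable_sampleCmom hX
    simp only [hD]; fun_prop
  have hDlim : ∀ᵐ ω ∂P, Tendsto (fun n => D n ω) atTop (𝓝 (sigma G ^ (2 * p - 1))⁻¹) := by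
    filter_upwards [ae_tendsto_sampleCmom hlaw hindep two_ne_zero
      (fun q hq => hint q (by lia)) hc1] with ω hω
    rw [sigma_pow_eq_rpow hσ hp]
    exact (hω.rpow_const (Or.inl hc2.ne')).inv₀ (Real.rpow_pos_of_pos hc2 _).ne'
  have hKlim : ∀ᵐ ω ∂P, Tendsto (fun n => centringCoeff G X (2 * p - 1) n ω) atTop
      (𝓝 (-((2 * p - 1) * cmom G (2 * p - 2)))) := by
    have h := ae_tendsto_centringCoeff hlaw hindep (k := 2 * p - 2)
      (fun q hq => hint q (by lia)) hc1
    rw [show 2 * p - 2 + 1 = 2 * p - 1 by lia, Nat.cast_sub (by lia)] at h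
    convert! h using 5
    push_cast
    ring
  have hmain := tendstoInMeasure_zero_add
    (tendstoInMeasure_zero_mul_normSum hlaw hindep hmom (j := 2 * p - 1) (by lia)
      (Y := fun n ω => D n ω - (sigma G ^ (2 * p - 1))⁻¹) (fun n => (hDm n).sub_const _)
      (by
        filter_upwards [hDlim] with ω hω
        simpa using hω.sub_const (sigma G ^ (2 * p - 1))⁻¹))
    (tendstoInMeasure_zero_mul_normSum hlaw hindep hmom (j := 1) (by lia)
      (Y := fun n ω => D n ω * centringCoeff G X (2 * p - 1) n ω -
        (sigma G ^ (2 * p - 1))⁻¹ * -((2 * p - 1) * cmom G (2 * p - 2)))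
      (fun n => ((hDm n).mul (aemeasurable_centringCoeff hX _ n)).sub_const _)
      (by
        filter_upwards [hDlim, hKlim] with ω h1 h2
        simpa using (h1.mul h2).sub_const
          ((sigma G ^ (2 * p - 1))⁻¹ * -((2 * p - 1) * cmom G (2 * p - 2)))))
  refine hmain.congr' ?_ ae_eq_rfl
  filter_upwards [eventually_ne_atTop 0] with n hn
  refine ae_of_all _ fun ω => ?_
  have hexp := sqrt_mul_sampleCmom (G := G) (X := X) hn (l := 2 * p - 1) (by lia) hc1 ω
  have hodd : normSum G X (oddPart G p) n ω = (sigma G ^ (2 * p - 1))⁻¹ *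
      normSum G X (fun x => (x - mom G 1) ^ (2 * p - 1)) n ω +
      (sigma G ^ (2 * p - 1))⁻¹ * -((2 * p - 1) * cmom G (2 * p - 2)) *
        normSum G X (fun x => (x - mom G 1) ^ 1) n ω := by
    rw [← normSum_add_mul (hint _ (by lia)) (hint _ (by lia))]
    congr 1
    ext x
    rw [oddPart]
    ring
  -- Exact even when `μ_{n,2} = 0`, because division is multiplication by the inverse.
  have hb : √(n : ℝ) * (bStat X n p ω - bPop G p) =
      D n ω * (√(n : ℝ) * (sampleCmom X n (2 * p - 1) ω - cmom G (2 * p - 1))) := by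
    rw [bStat, bPop, hcodd]
    simp only [hD]
    ring
  simp only [hb, hodd, hexp]
  ring

/-- Delta method for `φ(y) = y^{-p}`: the remainder is avoided through the exact identity `φ(y) -
φ(μ_2) = (y - μ_2) dslope φ μ_2 y`, with `dslope` continuous at `μ_2`. The centring coefficients of
orders `2p` and `2` tend to multiples of `μ_{2p-1}` and `μ_1`, hence to zero. -/
lemma tendstoInMeasure_aStat_sub [IsProbabilityMeasure P] [IsProbabilityMeasure G]
    (hlaw : ∀ i, HasLaw (X i) G P) (hindep : iIndepFun X P)
    (hsymm : IsSymmetric G) (hp : 1 ≤ p)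
    (hmom : Integrable (fun x : ℝ => x ^ (2 * (2 * p))) G) (hσ : 0 < sigma G) :
    TendstoInMeasure P
      (fun (n : ℕ) ω => √(n : ℝ) * (aStat X n p ω - aPop G p) - normSum G X (evenPart G p) n ω)
      atTop (fun _ => 0) := by
  have hX (i : ℕ) := (hlaw i).aemeasurable
  have hint1 : Integrable (fun x : ℝ => x) G := by
    simpa using integrable_sub_pow hmom 0 (j := 1) (by lia)
  have hc1 := cmom_eq_zero_of_odd hsymm hint1 (k := 1) ⟨0, rfl⟩
  have hcodd := cmom_eq_zero_of_odd hsymm hint1 (k := 2 * p - 1) ⟨p - 1, by lia⟩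
  have hint (q : ℕ) (hq : q ≤ 2 * p) := integrable_sub_pow hmom (mom G 1) (j := q) (by lia)
  have hc2 : 0 < cmom G 2 := by rw [← sq_sigma hσ]; positivity
  set φ : ℝ → ℝ := fun x => (x ^ p)⁻¹ with hφ
  set φ' : ℝ := -(p * cmom G 2 ^ (p - 1)) / (cmom G 2 ^ p) ^ 2 with hφ'
  have hderiv : HasDerivAt φ φ' (cmom G 2) :=
    (hasDerivAt_pow p (cmom G 2)).inv (by positivity)
  have hφm : Measurable φ := by fun_prop
  have hdm : Measurable (dslope φ (cmom G 2)) := by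
    have : Measurable (slope φ (cmom G 2)) := by
      unfold slope; simp only [vsub_eq_sub, smul_eq_mul]; fun_prop
    -- `dslope` differs from the measurable `slope` at most at the base point.
    refine this.measurable_of_countable_ne ((Set.countable_singleton (cmom G 2)).mono fun x hx =>
      ?_)
    by_contra hne
    exact hx (dslope_of_ne φ hne).symm
  have hmeas := aemeasurable_sampleCmom hX
  have h2lim := ae_tendsto_sampleCmom hlaw hindep two_ne_zero
    (fun q hq => hint q (by lia)) hc1
  have hφlim : ∀ᵐ ω ∂P, Tendsto (fun n => φ (sampleCmom X n 2 ω)) atTop (𝓝 (φ (cmom G 2))) := by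
    filter_upwards [h2lim] with ω hω using hderiv.continuousAt.tendsto.comp hω
  have hdlim : ∀ᵐ ω ∂P, Tendsto (fun n => dslope φ (cmom G 2) (sampleCmom X n 2 ω)) atTop
      (𝓝 φ') := by
    filter_upwards [h2lim] with ω hω
    have h := (continuousAt_dslope_same.2 hderiv.differentiableAt).tendsto.comp hω
    rwa [dslope_same, hderiv.deriv] at h
  have hKlim : ∀ᵐ ω ∂P, Tendsto (fun n => centringCoeff G X (2 * p) n ω) atTop (𝓝 0) := by
    have h := ae_tendsto_centringCoeff hlaw hindep (k := 2 * p - 1)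
      (fun q hq => hint q (by lia)) hc1
    simpa [show 2 * p - 1 + 1 = 2 * p by lia, hcodd] using h
  have hK2lim : ∀ᵐ ω ∂P, Tendsto (fun n => centringCoeff G X 2 n ω) atTop (𝓝 0) := by
    have h := ae_tendsto_centringCoeff hlaw hindep (k := 1)
      (fun q hq => hint q (by lia)) hc1
    simpa [hc1] using h
  have hmain := tendstoInMeasure_zero_add (tendstoInMeasure_zero_add
    (tendstoInMeasure_zero_mul_normSum hlaw hindep hmom (j := 2 * p) le_rfl
      (Y := fun n ω => φ (sampleCmom X n 2 ω) - φ (cmom G 2))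
      (fun n => (hφm.comp_aemeasurable (hmeas 2 n)).sub_const _)
      (by
        filter_upwards [hφlim] with ω hω
        simpa using hω.sub_const (φ (cmom G 2))))
    (tendstoInMeasure_zero_mul_normSum hlaw hindep hmom (j := 2) (by lia)
      (Y := fun n ω => cmom G (2 * p) * (dslope φ (cmom G 2) (sampleCmom X n 2 ω) - φ'))
      (fun n => ((hdm.comp_aemeasurable (hmeas 2 n)).sub_const _).const_mul _)
      (by
        filter_upwards [hdlim] with ω hω
        simpa using (hω.sub_const φ').const_mul (cmom G (2 * p)))))
    (tendstoInMeasure_zero_mul_normSum hlaw hindep hmom (j := 1) (by lia)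
      (Y := fun n ω => φ (sampleCmom X n 2 ω) * centringCoeff G X (2 * p) n ω +
        cmom G (2 * p) * dslope φ (cmom G 2) (sampleCmom X n 2 ω) * centringCoeff G X 2 n ω)
      (fun n => ((hφm.comp_aemeasurable (hmeas 2 n)).mul
          (aemeasurable_centringCoeff hX _ n)).add
        (((hdm.comp_aemeasurable (hmeas 2 n)).const_mul _).mul
          (aemeasurable_centringCoeff hX _ n)))
      (by
        filter_upwards [hφlim, hdlim, hKlim, hK2lim] with ω h1 h2 h3 h4
        simpa using (h1.mul h3).add ((h2.const_mul (cmom G (2 * p))).mul h4)))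
  refine hmain.congr' ?_ ae_eq_rfl
  filter_upwards [eventually_ne_atTop 0] with n hn
  refine ae_of_all _ fun ω => ?_
  have hexp := sqrt_mul_sampleCmom (G := G) (X := X) hn (l := 2 * p) (by lia) hc1 ω
  have hexp2 := sqrt_mul_sampleCmom (G := G) (X := X) hn (l := 2) two_ne_zero hc1 ω
  have heven : normSum G X (evenPart G p) n ω =
      φ (cmom G 2) * normSum G X (fun x => (x - mom G 1) ^ (2 * p)) n ω +
      cmom G (2 * p) * φ' * normSum G X (fun x => (x - mom G 1) ^ 2) n ω := by
    rw [← normSum_add_mul (hint _ (by lia)) (hint _ (by lia))]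
    congr 1
    ext x
    have hpow : cmom G 2 ^ p = cmom G 2 ^ (p - 1) * cmom G 2 := by
      rw [← pow_succ, Nat.sub_add_cancel hp]
    have hne : cmom G 2 ^ (p - 1) ≠ 0 := by positivity
    simp only [evenPart, pow_mul, sq_sigma hσ, hφ, hφ', hpow]
    field_simp
    ring
  have ha : √(n : ℝ) * (aStat X n p ω - aPop G p) =
      φ (sampleCmom X n 2 ω) * (√(n : ℝ) * (sampleCmom X n (2 * p) ω - cmom G (2 * p))) +
      cmom G (2 * p) * dslope φ (cmom G 2) (sampleCmom X n 2 ω) *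
        (√(n : ℝ) * (sampleCmom X n 2 ω - cmom G 2)) := by
    have hs := sub_smul_dslope φ (cmom G 2) (sampleCmom X n 2 ω)
    rw [smul_eq_mul] at hs
    rw [aStat, aPop, pow_mul, sq_sigma hσ, div_eq_mul_inv, div_eq_mul_inv]
    change √(n : ℝ) * (sampleCmom X n (2 * p) ω * φ (sampleCmom X n 2 ω) -
      cmom G (2 * p) * φ (cmom G 2)) = _
    linear_combination (-√(n : ℝ) * cmom G (2 * p)) * hs
  simp only [ha, heven, hexp, hexp2]
  ring

lemma tendstoInDistribution_bStat_aStat [IsProbabilityMeasure P] [IsProbabilityMeasure G]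
    (hlaw : ∀ i, HasLaw (X i) G P) (hindep : iIndepFun X P)
    (hsymm : IsSymmetric G) (hp : 1 ≤ p)
    (hmom : Integrable (fun x : ℝ => x ^ (4 * p)) G) (hσ : 0 < sigma G) :
    TendstoInDistribution
      (fun (n : ℕ) ω => (√(n : ℝ) * (bStat X n p ω - bPop G p), √(n : ℝ) * (aStat X n p ω - aPop
        G p)))
      atTop (id : ℝ × ℝ → ℝ × ℝ) (fun _ => P)
      ((gaussianReal 0 (bj G p).toNNReal).prod (gaussianReal 0 (aj G p).toNNReal)) := by
  replace hmom : Integrable (fun x : ℝ => x ^ (2 * (2 * p))) G := by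
    convert! hmom using 3
    ring
  have hint (q : ℕ) (hq : q ≤ 2 * p) : Integrable (fun x : ℝ => x ^ q) G := by
    simpa using integrable_sub_pow hmom 0 (j := q) (by lia)
  have hX (i : ℕ) := (hlaw i).aemeasurable
  have hclt := tendstoInDistribution_normSum_prodMk hlaw hindep measurable_oddPart
    (memLp_oddPart hp hmom) measurable_evenPart (memLp_evenPart hp hmom)
    (covariance_oddPart_evenPart hp hsymm hmom)
  rw [variance_oddPart hp hsymm hint, variance_evenPart hp hsymm hint] at hclt
  refine tendstoInDistribution_of_tendstoInMeasure_sub _ _ hclt ?_ fun n =>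
    (((aemeasurable_bStat hX p n).sub_const _).const_mul _).prodMk
      (((aemeasurable_aStat hX p n).sub_const _).const_mul _)
  refine tendstoInMeasure_zero_of_norm_le_add
    (tendstoInMeasure_bStat_sub hlaw hindep hsymm hp hmom hσ)
    (tendstoInMeasure_aStat_sub hlaw hindep hsymm hp hmom hσ) fun n ω => ?_
  -- The norm of a pair is the maximum of the two norms.
  exact max_le_add_of_nonneg (norm_nonneg _) (norm_nonneg _)

end Limits

/-! ### The chi-square limit -/

lemma map_prod_gaussianReal_eq_chiSquare {v w : ℝ} (hv : 0 < v) (hw : 0 < w) :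
    ((gaussianReal 0 v.toNNReal).prod (gaussianReal 0 w.toNNReal)).map
      (fun z : ℝ × ℝ => z.1 ^ 2 / v + z.2 ^ 2 / w) = chiSquare 2 := by
  have hmap {u : ℝ} (hu : 0 < u) :
      gaussianReal 0 u.toNNReal = (gaussianReal 0 1).map (√u * ·) := by
    rw [gaussianReal_map_const_mul]
    congr 1
    · simp
    · ext; simp [Real.sq_sqrt hu.le, hu.le]
  rw [hmap hv, hmap hw, Measure.map_prod_map _ _ (by fun_prop) (by fun_prop),
    Measure.map_map (by fun_prop) (by fun_prop), chiSquare,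
    ← (measurePreserving_finTwoArrow (gaussianReal 0 1)).map_eq,
    Measure.map_map (by fun_prop) (by fun_prop)]
  congr 1
  ext z
  simp only [Function.comp_apply, Prod.map_fst, Prod.map_snd, Fin.sum_univ_two, mul_pow,
    Real.sq_sqrt hv.le, Real.sq_sqrt hw.le, MeasurableEquiv.finTwoArrow_apply]
  field_simp

end JBTest

end

theorem mainTheorem3 {Ω : Type*} [MeasurableSpace Ω] (P : Measure Ω) [IsProbabilityMeasure P]
    (G : Measure ℝ) [IsProbabilityMeasure G] (X : ℕ → Ω → ℝ)
    (hlaw : ∀ i, HasLaw (X i) G P) (hindep : iIndepFun X P)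
    (hsymm : JBTest.IsSymmetric G) (p : ℕ) (hp : 2 ≤ p)
    (hmom : Integrable (fun x : ℝ => x ^ (4 * p)) G)
    (hnondeg : 0 < JBTest.sigma G) :
    TendstoInDistribution
        (fun (n : ℕ) (ω : Ω) =>
          (√(n : ℝ) * (JBTest.bStat X n p ω - JBTest.bPop G p),
            √(n : ℝ) * (JBTest.aStat X n p ω - JBTest.aPop G p)))
        atTop (id : ℝ × ℝ → ℝ × ℝ) (fun _ => P)
        ((gaussianReal 0 (JBTest.bj G p).toNNReal).prod
          (gaussianReal 0 (JBTest.aj G p).toNNReal)) ∧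
      (JBTest.bj G p ≠ 0 → JBTest.aj G p ≠ 0 →
        TendstoInDistribution
          (fun (n : ℕ) (ω : Ω) =>
            (n : ℝ) * (JBTest.bStat X n p ω ^ 2 / JBTest.bj G p +
              (JBTest.aStat X n p ω - JBTest.aPop G p) ^ 2 / JBTest.aj G p))
          atTop (id : ℝ → ℝ) (fun _ => P) (JBTest.chiSquare 2)) := by
  have hmain := JBTest.tendstoInDistribution_bStat_aStat hlaw hindep hsymm (by lia : 1 ≤ p)
    hmom hnondeg
  refine ⟨hmain, fun hb ha => ?_⟩
  have hb' : 0 < JBTest.bj G p := lt_of_le_of_ne (variance_nonneg _ _) hb.symm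
  have ha' : 0 < JBTest.aj G p := lt_of_le_of_ne (variance_nonneg _ _) ha.symm
  have hint1 : Integrable (fun x : ℝ => x) G := by
    simpa using JBTest.integrable_sub_pow (k := 2 * p) (by convert! hmom using 3; ring)
      0 (j := 1) (by lia)
  -- This is why `b_{n,p}` appears uncentred in the chi-square statistic.
  have hbPop : JBTest.bPop G p = 0 := by
    rw [JBTest.bPop, JBTest.cmom_eq_zero_of_odd hsymm hint1 ⟨p - 1, by lia⟩, zero_div]
  have h := hmain.continuous_comp
    (g := fun z : ℝ × ℝ => z.1 ^ 2 / JBTest.bj G p + z.2 ^ 2 / JBTest.aj G p) (by fun_prop)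
  have hfun (n : ℕ) (ω : Ω) : (n : ℝ) * (JBTest.bStat X n p ω ^ 2 / JBTest.bj G p +
      (JBTest.aStat X n p ω - JBTest.aPop G p) ^ 2 / JBTest.aj G p) =
      (√(n : ℝ) * (JBTest.bStat X n p ω - JBTest.bPop G p)) ^ 2 / JBTest.bj G p +
        (√(n : ℝ) * (JBTest.aStat X n p ω - JBTest.aPop G p)) ^ 2 / JBTest.aj G p := by
    rw [hbPop, mul_pow, mul_pow, Real.sq_sqrt (by positivity)]
    ring
  simp_rw [hfun]
  refine ⟨h.forall_aemeasurable, aemeasurable_id, ?_⟩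
  convert! h.tendsto using 1
  exact congrArg nhds (Subtype.ext (Measure.map_id.trans
    (JBTest.map_prod_gaussianReal_eq_chiSquare hb' ha').symm))
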